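/- Let $g\ge 1$, let $p\ge 5$ be a prime, and let $c$ be an integer with $0\le c\le (p-3)/2$. The lollipop tree $T_g$ is the following graph with $g$ loop edges, $g$ stick edges and one free edge, the trunk. For $1\le i\le g$ the $i$-th stick joins the base vertex of the $i$-th loop to the rest of the tree. Put $\beta_1=$ the first stick; for $2\le i\le g$ there is a trivalent vertex at which $\beta_{i-1}$, the $i$-th stick and a new edge $\beta_i$ meet; the trunk is $\beta_g$. A coloring of $T_g$ with trunk color $2c$ assigns to each edge a color in $\{0,1,\dots,p-2\}$, with $2c$ on the trunk, such that - the colors $i,j,k$ at each trivalent vertex (a loop being counted twice at its base vertex) satisfy $i+j+k\equiv 0 \pmod 2$, $|i-j|\le k\le i+j$ and $i+j+k\le 2p-4$; - every loop has color at most $(p-3)/2$. The stick colors are then even; write $2a_1,\dots,2a_g$ for them. For $g\ge 3$, a coloring is called even or odd according as $c+\sum_{i=1}^g a_i$ is even or odd. Let $\mathfrak e_g^{(2c)}(p)$ and $\mathfrak o_g^{(2c)}(p)$ be the numbers of even and of odd colorings of $T_g$ with trunk color $2c$. Let $$\widetilde B_n=\frac12\,\frac{(-1)^{n+1}B_{2n}}{(2n)!}\qquad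 (n\ge 1),$$ where the Bernoulli numbers $B_n$ are defined by $\frac{t}{e^t-1}=\sum_{n\ge0}B_n\frac{t^n}{n!}$. **Corollary.** Let $g\ge 3$ and let $c\ge 0$ be a fixed integer. Then, as functions of the prime $p\ge 5$ with $c\le (p-3)/2$, both $\mathfrak e_g^{(2c)}(p)$ and $\mathfrak o_g^{(2c)}(p)$ are given by polynomials in $p$ with rational coefficients, depending only on $g$ and $c$, each of degree $3g-3$ and with leading coefficient $\left(c+\tfrac12\right)\widetilde B_{g-1}$. -/

import Mathlib

/-- The edges of the lollipop tree of genus `g ≥ 1` with one free (trunk) edge. The sticks are the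
edges that join a loop to the rest of the tree. `spine j` is the edge that leaves the `j`-th stick
vertex towards the trunk. -/
inductive LollipopEdge (g : ℕ) where
  | loop (i : Fin g)
  | stick (i : Fin g)
  | spine (j : Fin (g - 1))

/-- The edge that leaves, in direction of the trunk, the part of the lollipop tree containing
exactly the lollipops `0, …, i`. It is stick `0` for `i = 0`, and the spine edge leaving the
`i`-th stick vertex for `i ≥ 1`. The trunk is the last of these edges, `i = g - 1`. -/
def LollipopEdge.branch {g : ℕ} (i : Fin g) : LollipopEdge g :=
  if h : i.val = 0 then .stick i else .spine ⟨i.val - 1, by omega⟩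

/-- Admissibility of three colors that meet at a trivalent vertex:
`i + j + k` is even, `|i - j| ≤ k ≤ i + j`, and `i + j + k ≤ 2 p - 4`. -/
def AdmissibleTriple (p i j k : ℕ) : Prop :=
  Even (i + j + k) ∧ |(i : ℤ) - j| ≤ k ∧ k ≤ i + j ∧ i + j + k + 4 ≤ 2 * p

/-- The small admissible colorings of the lollipop tree of genus `g` whose trunk has color `2 c`. -/
structure IsLollipopColoring (p g c : ℕ) (σ : LollipopEdge g → ℕ) : Prop where
  /-- The colors lie in `{0, …, p - 2}`. -/
  color_le : ∀ e, σ e + 2 ≤ p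
  /-- Admissibility at the vertex where stick `i` meets both ends of loop `i`. -/
  loop_vertex : ∀ i : Fin g, AdmissibleTriple p (σ (.stick i)) (σ (.loop i)) (σ (.loop i))
  /-- Admissibility at the stick vertex where lollipop `j = i + 1` is attached. -/
  stick_vertex : ∀ i j : Fin g, j.val = i.val + 1 →
    AdmissibleTriple p (σ (.branch i)) (σ (.stick j)) (σ (.branch j))
  /-- Smallness: the colors of the loops are at most `(p - 3) / 2`. -/
  small : ∀ i : Fin g, 2 * σ (.loop i) + 3 ≤ p
  /-- The trunk has color `2 c`. -/
  trunk : ∀ i : Fin g, i.val + 1 = g → σ (.branch i) = 2 * c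

/-- The number `c + ∑ aᵢ`, where stick `i` has color `2 aᵢ`
(admissibility forces the color of a stick to be even, so the halving is exact). -/
def lollipopParity {g : ℕ} (c : ℕ) (σ : LollipopEdge g → ℕ) : ℕ :=
  c + ∑ i : Fin g, σ (.stick i) / 2

/-- The number of even colorings of the lollipop tree of genus `g` with trunk color `2 c`. -/
noncomputable def evenColorings (p g c : ℕ) : ℕ :=
  {σ : LollipopEdge g → ℕ | IsLollipopColoring p g c σ ∧ Even (lollipopParity c σ)}.ncard

/-- The number of odd colorings of the lollipop tree of genus `g` with trunk color `2 c`. -/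
noncomputable def oddColorings (p g c : ℕ) : ℕ :=
  {σ : LollipopEdge g → ℕ | IsLollipopColoring p g c σ ∧ Odd (lollipopParity c σ)}.ncard

/-- The modified Bernoulli number `(1/2) (-1)^(n+1) B_{2n} / (2n)!`, which is
`ζ(2n) / (2π)^(2n)` for `n ≥ 1`. -/
def modifiedBernoulli (n : ℕ) : ℚ :=
  1 / 2 * ((-1) ^ (n + 1) * bernoulli (2 * n) / ((2 * n).factorial : ℚ))

/-!
Let `p = 2 m + 1`. For `ε = ± 1` consider the sum of `ε ^ (c + ∑ aᵢ)` over all colorings with trunk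
color `2 c`. Half the sum and half the difference of the two values are the numbers of even and of
odd colorings.

Removing the last lollipop gives a recursion in the genus (`weightedCount_succ`): a stick of color
`2 b` carries `m - b` small loops, and summing over `b` yields a kernel in the colors `2 a` and `2 c`
of the last two branches. This kernel is the Green's function `(1 + t min(a, c)) (m - max(a, c))` of
the discrete Laplacian on `{0, …, m - 1}`, with `t = 2` for `ε = 1` and `t = 0` for `ε = -1`
(`transferKernel_one`, `transferKernel_neg_one`). Hence, as functions of `c`, the weighted counts
solve the discrete Poisson equations `f'' = -(1 + t m) * (previous f)`, vanish at `c = m`, and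
satisfy a parity condition at the other end.

These equations are solved in the basis of central factorials, which the second difference shifts
(`iterate_greenKernel`). In each step a single new coefficient appears, a polynomial in `p` that is
fixed by the zero at `c = m`; these conditions form a convolution equation. For `ε = 1` the solution
has degree at most `3 s`, where `g = s + 1`, and its coefficient in degree `3 s` satisfies the
recursion of the modified Bernoulli numbers (`sum_modifiedBernoulli`), a form of the vanishing of
the Bernoulli polynomials of odd index at `1 / 2`. For fixed `c`, the leading term comes from the
lowest odd central factorial `2 c + 1` alone. For `ε = -1` the degree is at most `2 s + 1`, which is
less than `3 s` for `s ≥ 2`; so even and odd colorings have the same leading term, and it does not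
vanish because `ζ(2 s) ≠ 0`.
-/

open Finset

/-! ### Admissible triples and the edges of the lollipop tree -/

theorem admissibleTriple_loop_iff {m s l : ℕ} (hl : l < m) :
    AdmissibleTriple (2 * m + 1) s l l ↔ Even s ∧ s ≤ 2 * l := by
  unfold AdmissibleTriple
  rw [abs_le, Nat.even_iff, Nat.even_iff]
  omega

theorem admissibleTriple_two_mul_iff {m a b c : ℕ} :
    AdmissibleTriple (2 * m + 1) (2 * a) (2 * b) (2 * c) ↔
      a ≤ b + c ∧ b ≤ a + c ∧ c ≤ a + b ∧ a + b + c + 1 ≤ 2 * m := by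
  unfold AdmissibleTriple
  rw [abs_le, Nat.even_iff]
  omega

namespace LollipopEdge

instance instFinite (g : ℕ) : Finite (LollipopEdge g) :=
  Finite.of_surjective
    (fun x : Fin g ⊕ Fin g ⊕ Fin (g - 1) =>
      Sum.elim LollipopEdge.loop (Sum.elim LollipopEdge.stick LollipopEdge.spine) x)
    (by
      rintro (i | i | j)
      · exact ⟨.inl i, rfl⟩
      · exact ⟨.inr (.inl i), rfl⟩
      · exact ⟨.inr (.inr j), rfl⟩)

/-- The inclusion of the edges of the lollipop tree of genus `n + 1` into those of the tree of
genus `n + 2`, whose additional edges are the last loop, the last stick and the new trunk. -/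
def castSucc {n : ℕ} : LollipopEdge (n + 1) → LollipopEdge (n + 2)
  | loop i => loop i.castSucc
  | stick i => stick i.castSucc
  | spine j => spine ⟨j.val, by omega⟩

theorem castSucc_branch {n : ℕ} (i : Fin (n + 1)) :
    castSucc (branch i) = branch i.castSucc := by
  unfold branch
  by_cases h : i.val = 0 <;> simp [h, castSucc]

theorem branch_last {n : ℕ} :
    branch (Fin.last (n + 1)) = (spine ⟨n, by omega⟩ : LollipopEdge (n + 2)) := by
  simp [branch]

/-- The coloring of the tree of genus `n + 2` that extends `σ` by the color `l` of the last loop,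
the color `b` of the last stick and the color `t` of the trunk. -/
def extend {n : ℕ} (σ : LollipopEdge (n + 1) → ℕ) (l b t : ℕ) : LollipopEdge (n + 2) → ℕ
  | loop i => if h : i.val < n + 1 then σ (loop ⟨i.val, h⟩) else l
  | stick i => if h : i.val < n + 1 then σ (stick ⟨i.val, h⟩) else b
  | spine j => if h : j.val < n then σ (spine ⟨j.val, h⟩) else t

variable {n : ℕ} (σ : LollipopEdge (n + 1) → ℕ) (l b t : ℕ)

theorem extend_castSucc (e : LollipopEdge (n + 1)) : extend σ l b t (castSucc e) = σ e := by
  rcases e with i | i | j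
  · exact dif_pos i.isLt
  · exact dif_pos i.isLt
  · exact dif_pos j.isLt

theorem extend_loop_last : extend σ l b t (loop (Fin.last (n + 1))) = l := by simp [extend]

theorem extend_stick_last : extend σ l b t (stick (Fin.last (n + 1))) = b := by simp [extend]

theorem extend_branch_last : extend σ l b t (branch (Fin.last (n + 1))) = t := by
  simp [branch_last, extend]

theorem extend_branch_castSucc (i : Fin (n + 1)) :
    extend σ l b t (branch i.castSucc) = σ (branch i) := by
  rw [← castSucc_branch, extend_castSucc]

/-- Every edge is an old edge, the last loop, the last stick or the trunk. -/
theorem cases_castSucc (e : LollipopEdge (n + 2)) :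
    (∃ e', e = castSucc e') ∨ e = loop (Fin.last _) ∨ e = stick (Fin.last _) ∨
      e = branch (Fin.last _) := by
  rcases e with i | i | j
  · induction i using Fin.lastCases with
    | last => simp
    | cast i => exact .inl ⟨loop i, rfl⟩
  · induction i using Fin.lastCases with
    | last => simp
    | cast i => exact .inl ⟨stick i, rfl⟩
  · by_cases h : j.val < n
    · exact .inl ⟨spine ⟨j.val, h⟩, rfl⟩
    · refine .inr (.inr (.inr ?_))
      rw [branch_last]
      exact congrArg spine (Fin.ext (show j.val = n by omega))

theorem extend_restrict (τ : LollipopEdge (n + 2) → ℕ) :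
    extend (fun e => τ (castSucc e)) (τ (loop (Fin.last _))) (τ (stick (Fin.last _)))
      (τ (branch (Fin.last _))) = τ := by
  funext e
  rcases cases_castSucc e with ⟨e', rfl⟩ | rfl | rfl | rfl
  · rw [extend_castSucc]
  · rw [extend_loop_last]
  · rw [extend_stick_last]
  · rw [extend_branch_last]

end LollipopEdge

open LollipopEdge

/-! ### Weighted counts of colorings and their recursion in the genus -/

theorem finite_setOf_isLollipopColoring (p g c : ℕ) :
    {σ : LollipopEdge g → ℕ | IsLollipopColoring p g c σ}.Finite := by
  refine (Set.Finite.pi' (fun _ : LollipopEdge g => Set.finite_Iio p)).subset ?_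
  intro σ hσ e
  have := hσ.color_le e
  simp only [Set.mem_Iio]
  omega

/-- The finite set of all small admissible colorings with trunk color `2 c`. -/
noncomputable def lollipopColorings (p g c : ℕ) : Finset (LollipopEdge g → ℕ) :=
  (finite_setOf_isLollipopColoring p g c).toFinset

theorem mem_lollipopColorings {p g c : ℕ} {σ : LollipopEdge g → ℕ} :
    σ ∈ lollipopColorings p g c ↔ IsLollipopColoring p g c σ := by
  simp [lollipopColorings]

/-- The sum of `ε ^ (c + ∑ aᵢ)` over all colorings with trunk color `2 c`. For `ε = 1` this is the
number of colorings, for `ε = -1` the difference of the numbers of even and odd colorings. -/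
noncomputable def weightedCount (ε : ℚ) (p g c : ℕ) : ℚ :=
  ∑ σ ∈ lollipopColorings p g c, ε ^ lollipopParity c σ

theorem evenColorings_eq (p g c : ℕ) : (evenColorings p g c : ℚ) =
    (weightedCount 1 p g c + weightedCount (-1) p g c) / 2 := by
  classical
  have h : {σ : LollipopEdge g → ℕ | IsLollipopColoring p g c σ ∧ Even (lollipopParity c σ)} =
      ↑((lollipopColorings p g c).filter fun σ => Even (lollipopParity c σ)) := by
    ext σ; simp [mem_lollipopColorings]
  rw [evenColorings, h, Set.ncard_coe_finset, card_filter, weightedCount, weightedCount,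
    ← sum_add_distrib, sum_div, Nat.cast_sum]
  refine sum_congr rfl fun σ _ => ?_
  rcases Nat.even_or_odd (lollipopParity c σ) with h | h
  · simp [h, h.neg_one_pow]
  · simp [Nat.not_even_iff_odd.2 h, h.neg_one_pow]

theorem oddColorings_eq (p g c : ℕ) : (oddColorings p g c : ℚ) =
    (weightedCount 1 p g c - weightedCount (-1) p g c) / 2 := by
  classical
  have h : {σ : LollipopEdge g → ℕ | IsLollipopColoring p g c σ ∧ Odd (lollipopParity c σ)} =
      ↑((lollipopColorings p g c).filter fun σ => Odd (lollipopParity c σ)) := by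
    ext σ; simp [mem_lollipopColorings]
  rw [oddColorings, h, Set.ncard_coe_finset, card_filter, weightedCount, weightedCount,
    ← sum_sub_distrib, sum_div, Nat.cast_sum]
  refine sum_congr rfl fun σ _ => ?_
  rcases Nat.even_or_odd (lollipopParity c σ) with h | h
  · simp [Nat.not_odd_iff_even.2 h, h.neg_one_pow]
  · simp [h, h.neg_one_pow]

theorem weightedCount_one {ε : ℚ} (hε : ε ^ 2 = 1) {m c : ℕ} (hc : c ≤ m) :
    weightedCount ε (2 * m + 1) 1 c = m - c := by
  have key : ∀ σ ∈ lollipopColorings (2 * m + 1) 1 c,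
      σ (.stick 0) = 2 * c ∧ c ≤ σ (.loop 0) ∧ σ (.loop 0) < m := by
    intro σ hσ
    rw [mem_lollipopColorings] at hσ
    have h1 : σ (.stick 0) = 2 * c := hσ.trunk 0 rfl
    have h2 := hσ.small 0
    have h3 := ((admissibleTriple_loop_iff (by omega)).1 (hσ.loop_vertex 0)).2
    exact ⟨h1, by omega, by omega⟩
  have h : ∑ σ ∈ lollipopColorings (2 * m + 1) 1 c, ε ^ lollipopParity c σ =
      ∑ l ∈ Ico c m, (1 : ℚ) := by
    refine sum_nbij' (fun σ => σ (.loop 0))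
      (fun l e => match e with | .loop _ => l | .stick _ => 2 * c | .spine _ => 0) ?_ ?_ ?_ ?_ ?_
    · intro σ hσ
      exact mem_Ico.2 (key σ hσ).2
    · intro l hl
      rw [mem_Ico] at hl
      rw [mem_lollipopColorings]
      refine ⟨?_, ?_, ?_, ?_, ?_⟩
      · rintro (i | i | j) <;> simp only <;> omega
      · intro i
        exact (admissibleTriple_loop_iff hl.2).2 ⟨even_two_mul c, Nat.mul_le_mul_left 2 hl.1⟩
      · intro i j h
        omega
      · intro i
        simp only
        omega
      · intro i _
        have : i = 0 := Subsingleton.elim _ _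
        subst this
        rfl
    · intro σ hσ
      funext e
      rcases e with i | i | j
      · rw [Subsingleton.elim i 0]
      · rw [Subsingleton.elim i 0]
        exact (key σ hσ).1.symm
      · exact j.elim0
    · intro l _
      rfl
    · intro σ hσ
      have : lollipopParity c σ = 2 * c := by
        simp [lollipopParity, (key σ hσ).1]
        omega
      rw [this, pow_mul, hε, one_pow]
  rw [weightedCount, h]
  simp [Nat.cast_sub hc]

/-- The colors `(2 a, 2 b, 2 c)` are admissible at a trivalent vertex, for `p = 2 m + 1`. -/
def Fuses (m a b c : ℕ) : Prop :=
  a ≤ b + c ∧ b ≤ a + c ∧ c ≤ a + b ∧ a + b + c + 1 ≤ 2 * m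

instance (m a b c : ℕ) : Decidable (Fuses m a b c) := by
  unfold Fuses; infer_instance

theorem IsLollipopColoring.extend {m n a b c l : ℕ} {σ : LollipopEdge (n + 1) → ℕ}
    (hσ : IsLollipopColoring (2 * m + 1) (n + 1) a σ) (hc : c < m) (hb : b ≤ l) (hl : l < m)
    (h : Fuses m a b c) :
    IsLollipopColoring (2 * m + 1) (n + 2) c (LollipopEdge.extend σ l (2 * b) (2 * c)) := by
  refine ⟨?_, ?_, ?_, ?_, ?_⟩
  · intro e
    rcases cases_castSucc e with ⟨e', rfl⟩ | rfl | rfl | rfl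
    · rw [extend_castSucc]; exact hσ.color_le e'
    · rw [extend_loop_last]; omega
    · rw [extend_stick_last]; omega
    · rw [extend_branch_last]; omega
  · intro i
    induction i using Fin.lastCases with
    | last =>
      rw [extend_loop_last, extend_stick_last, admissibleTriple_loop_iff hl]
      exact ⟨even_two_mul b, by omega⟩
    | cast i =>
      have := hσ.loop_vertex i
      rwa [← extend_castSucc σ l (2 * b) (2 * c), ← extend_castSucc σ l (2 * b) (2 * c)] at this
  · intro i j hij
    induction i using Fin.lastCases with
    | last => simp at hij; omega
    | cast i =>
      induction j using Fin.lastCases with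
      | last =>
        rw [extend_branch_castSucc, extend_stick_last, extend_branch_last,
          hσ.trunk i (by simpa using hij.symm), admissibleTriple_two_mul_iff]
        exact h
      | cast j =>
        rw [extend_branch_castSucc, extend_branch_castSucc]
        have := hσ.stick_vertex i j (by simpa using hij)
        rwa [← extend_castSucc σ l (2 * b) (2 * c) (.stick j)] at this
  · intro i
    induction i using Fin.lastCases with
    | last => rw [extend_loop_last]; omega
    | cast i =>
      have := hσ.small i
      rwa [← extend_castSucc σ l (2 * b) (2 * c)] at this
  · intro i hi
    have : i = Fin.last _ := Fin.ext (by simpa using hi)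
    rw [this, extend_branch_last]

theorem IsLollipopColoring.restrict {m n c : ℕ} {τ : LollipopEdge (n + 2) → ℕ}
    (hτ : IsLollipopColoring (2 * m + 1) (n + 2) c τ) :
    ∃ a b l, τ (branch (Fin.last n).castSucc) = 2 * a ∧ τ (.stick (Fin.last _)) = 2 * b ∧
      τ (.loop (Fin.last _)) = l ∧ a < m ∧ b ≤ l ∧ l < m ∧ Fuses m a b c ∧
      IsLollipopColoring (2 * m + 1) (n + 1) a (fun e => τ (castSucc e)) := by
  have hl := hτ.small (Fin.last _)
  obtain ⟨⟨b, hb⟩, hbl⟩ := (admissibleTriple_loop_iff (by omega)).1 (hτ.loop_vertex (Fin.last _))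
  rw [← two_mul] at hb
  have hv := hτ.stick_vertex (Fin.last n).castSucc (Fin.last _) (by simp)
  rw [hb, hτ.trunk (Fin.last _) (by simp)] at hv
  obtain ⟨a, ha⟩ : ∃ a, τ (branch (Fin.last n).castSucc) = 2 * a := by
    obtain ⟨k, hk⟩ := hv.1
    exact ⟨k - b - c, by omega⟩
  rw [ha, admissibleTriple_two_mul_iff] at hv
  have ham := hτ.color_le (branch (Fin.last n).castSucc)
  refine ⟨a, b, _, ha, hb, rfl, by omega, by omega, by omega, hv, ?_⟩
  refine ⟨fun e => hτ.color_le _, fun i => hτ.loop_vertex i.castSucc, ?_,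
    fun i => hτ.small i.castSucc, ?_⟩
  · intro i j hij
    rw [castSucc_branch, castSucc_branch]
    exact hτ.stick_vertex i.castSucc j.castSucc (by simpa using hij)
  · intro i hi
    have : i = Fin.last _ := Fin.ext (by simpa using hi)
    rw [this, castSucc_branch, ha]

theorem lollipopParity_extend {n : ℕ} (σ : LollipopEdge (n + 1) → ℕ) (a b c l t : ℕ) :
    a + lollipopParity c (LollipopEdge.extend σ l (2 * b) t) =
      lollipopParity a σ + (b + c) := by
  simp only [lollipopParity]
  rw [Fin.sum_univ_castSucc (n := n + 1), extend_stick_last]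
  have h : ∀ i : Fin (n + 1), LollipopEdge.extend σ l (2 * b) t (.stick i.castSucc) =
      σ (.stick i) := fun i => extend_castSucc σ l (2 * b) t (.stick i)
  simp only [h]
  omega

/-- The contribution to the weighted count of the last lollipop, attached between edges of colors
`2 a` and `2 c`: a stick of color `2 b` carries `m - b` small loops. -/
def transferKernel (ε : ℚ) (m a c : ℕ) : ℚ :=
  ∑ b ∈ range m with Fuses m a b c, ε ^ (a + b + c) * (m - b : ℚ)

theorem weightedCount_succ {ε : ℚ} (hε : ε ^ 2 = 1) {m c : ℕ} (n : ℕ) (hc : c < m) :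
    weightedCount ε (2 * m + 1) (n + 2) c =
      ∑ a ∈ range m, transferKernel ε m a c * weightedCount ε (2 * m + 1) (n + 1) a := by
  have h1 : weightedCount ε (2 * m + 1) (n + 2) c =
      ∑ x ∈ (range m).sigma fun a =>
          (((range m).filter fun b => Fuses m a b c).sigma fun b => Ico b m) ×ˢ
            lollipopColorings (2 * m + 1) (n + 1) a,
        ε ^ (x.1 + x.2.1.1 + c) * ε ^ lollipopParity x.1 x.2.2 := by
    refine sum_nbij'
      (fun τ => ⟨τ (branch (Fin.last n).castSucc) / 2,
        ⟨τ (.stick (Fin.last _)) / 2, τ (.loop (Fin.last _))⟩, fun e => τ (castSucc e)⟩)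
      (fun x => LollipopEdge.extend x.2.2 x.2.1.2 (2 * x.2.1.1) (2 * c)) ?_ ?_ ?_ ?_ ?_
    · intro τ hτ
      obtain ⟨a, b, l, ha, hb, hl, ham, hbl, hlm, hF, h⟩ :=
        (mem_lollipopColorings.1 hτ).restrict
      simp only [mem_sigma, mem_product, mem_filter, mem_range, mem_Ico, ha, hb, hl,
        mem_lollipopColorings, Nat.mul_div_cancel_left _ two_pos]
      exact ⟨ham, ⟨⟨by omega, hF⟩, hbl, hlm⟩, h⟩
    · rintro ⟨a, ⟨b, l⟩, σ⟩ hx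
      simp only [mem_sigma, mem_product, mem_filter, mem_range, mem_Ico,
        mem_lollipopColorings] at hx
      obtain ⟨ham, ⟨⟨-, hF⟩, hbl, hlm⟩, h⟩ := hx
      exact mem_lollipopColorings.2 (h.extend hc hbl hlm hF)
    · intro τ hτ
      have hτ' := mem_lollipopColorings.1 hτ
      obtain ⟨a, b, l, ha, hb, hl, -⟩ := hτ'.restrict
      have ht := hτ'.trunk (Fin.last _) (by simp)
      have := extend_restrict τ
      rw [hb, ht] at this
      simpa only [hb, Nat.mul_div_cancel_left _ two_pos] using this
    · rintro ⟨a, ⟨b, l⟩, σ⟩ hx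
      simp only [mem_sigma, mem_product, mem_lollipopColorings] at hx
      have ht := hx.2.2.trunk (Fin.last _) (by simp)
      simp only [extend_branch_castSucc, extend_stick_last, extend_loop_last, extend_castSucc, ht,
        Nat.mul_div_cancel_left _ two_pos]
    · intro τ hτ
      have hτ' := mem_lollipopColorings.1 hτ
      obtain ⟨a, b, l, ha, hb, hl, -⟩ := hτ'.restrict
      have ht := hτ'.trunk (Fin.last _) (by simp)
      have hp := lollipopParity_extend (fun e => τ (castSucc e)) a b c l (2 * c)
      have := extend_restrict τ
      rw [hb, ht, hl] at this
      rw [this] at hp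
      simp only [ha, hb, Nat.mul_div_cancel_left _ two_pos]
      have hpar : lollipopParity c τ + 2 * a =
          (a + b + c) + lollipopParity a (fun e => τ (castSucc e)) := by omega
      rw [← pow_add, ← hpar, pow_add, pow_mul, hε, one_pow, mul_one]
  rw [h1, sum_sigma]
  refine sum_congr rfl fun a _ => ?_
  rw [sum_product, sum_sigma, transferKernel, sum_mul]
  refine sum_congr rfl fun b hb => ?_
  have hb' : b ≤ m := (mem_range.1 (mem_filter.1 hb).1).le
  simp only [← mul_sum, weightedCount, sum_const, Nat.card_Ico, nsmul_eq_mul, Nat.cast_sub hb']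
  ring

/-! ### The transfer kernel as a Green's function -/

theorem sum_range_sub_cast (x : ℚ) (K : ℕ) :
    ∑ i ∈ range K, (x - i) = K * x - K * (K - 1) / 2 := by
  induction K with
  | zero => simp
  | succ K ih => rw [sum_range_succ, ih]; push_cast; ring

theorem sum_range_two_mul_alternating (x : ℚ) (r : ℕ) :
    ∑ i ∈ range (2 * r), (-1) ^ i * (x - i) = r := by
  induction r with
  | zero => simp
  | succ r ih =>
    rw [mul_add, mul_one, sum_range_succ, sum_range_succ, ih, pow_succ, pow_mul]
    push_cast
    simp
    ring

theorem transferKernel_eq_sum {ε : ℚ} (hε : ε ^ 2 = 1) {m a c : ℕ} (ha : a < m) (hc : c < m) :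
    transferKernel ε m a c = ∑ i ∈ range (min (2 * min a c + 1) (2 * (m - max a c))),
      ε ^ i * ((m : ℚ) - (max a c - min a c) - i) := by
  have hs : (range m).filter (fun b => Fuses m a b c) = Ico (max a c - min a c)
      (max a c - min a c + min (2 * min a c + 1) (2 * (m - max a c))) := by
    ext b
    rw [mem_filter, mem_range, mem_Ico, Fuses]
    omega
  rw [transferKernel, hs, sum_Ico_eq_sum_range, Nat.add_sub_cancel_left]
  refine sum_congr rfl fun i _ => ?_
  have he : a + (max a c - min a c + i) + c = 2 * max a c + i := by omega
  rw [he, pow_add, pow_mul, hε, one_pow, one_mul, Nat.cast_add,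
    Nat.cast_sub (min_le_max), Nat.cast_max, Nat.cast_min]
  ring

/-- The Green's function of the discrete Laplacian on `{0, …, m - 1}`, with the boundary conditions
`f m = 0` and `f (-1) = (1 - t) * f 0`. The values that occur are `t = 2` and `t = 0`, for functions
that are odd, respectively even, under `c ↦ -1 - c`. -/
def greenKernel (t : ℚ) (m a c : ℕ) : ℚ :=
  (1 + t * (min a c : ℕ)) * (m - (max a c : ℕ))

/-- The number of admissible stick colors is `min (2 min(a, c) + 1) (2 (m - max(a, c)))`; in both
cases the arithmetic progression `m - b` has the same sum. -/
theorem transferKernel_one {m a c : ℕ} (ha : a < m) (hc : c < m) :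
    transferKernel 1 m a c = greenKernel 2 m a c := by
  rw [transferKernel_eq_sum (by norm_num) ha hc]
  simp only [one_pow, one_mul]
  rw [sum_range_sub_cast, greenKernel]
  have hM : max a c < m := by omega
  generalize max a c = M at *
  generalize min a c = N at *
  rcases le_total (2 * N + 1) (2 * (m - M)) with h | h
  · rw [min_eq_left h]; push_cast; ring
  · rw [min_eq_right h]; push_cast [Nat.cast_sub hM.le]; ring

/-- Two consecutive summands add up to `1`. An odd number of summands leaves the last one,
`m - (a + c)`, unpaired. -/
theorem transferKernel_neg_one {m a c : ℕ} (ha : a < m) (hc : c < m) :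
    transferKernel (-1) m a c = greenKernel 0 m a c := by
  rw [transferKernel_eq_sum (by norm_num) ha hc, greenKernel]
  have hM : max a c < m := by omega
  generalize max a c = M at *
  generalize min a c = N at *
  rcases le_total (2 * N + 1) (2 * (m - M)) with h | h
  · rw [min_eq_left h, sum_range_succ, sum_range_two_mul_alternating, pow_mul]
    push_cast
    norm_num
    ring
  · rw [min_eq_right h, sum_range_two_mul_alternating, Nat.cast_sub hM.le]
    ring

theorem greenKernel_self_right (t : ℚ) {m a : ℕ} (ha : a < m) : greenKernel t m a m = 0 := by
  simp [greenKernel, ha.le]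

theorem greenKernel_boundary (t : ℚ) (m a : ℕ) :
    greenKernel t m a 1 - (1 + t) * greenKernel t m a 0 = if a = 0 then -(1 + t * m) else 0 := by
  rcases a with _ | a
  · simp [greenKernel]; ring
  · simp [greenKernel]

theorem greenKernel_secondDifference (t : ℚ) (m a c : ℕ) :
    greenKernel t m a (c + 2) - 2 * greenKernel t m a (c + 1) + greenKernel t m a c =
      if a = c + 1 then -(1 + t * m) else 0 := by
  unfold greenKernel
  rcases lt_trichotomy a (c + 1) with h | h | h
  · rw [if_neg h.ne, min_eq_left (by omega), min_eq_left (by omega), min_eq_left (by omega),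
      max_eq_right (by omega), max_eq_right (by omega), max_eq_right (by omega)]
    push_cast; ring
  · subst h
    rw [if_pos rfl, min_eq_left (by omega), min_self, min_eq_right (by omega),
      max_eq_right (by omega), max_self, max_eq_left (by omega)]
    push_cast; ring
  · rw [if_neg h.ne', min_eq_right (by omega), min_eq_right (by omega), min_eq_right (by omega),
      max_eq_left (by omega), max_eq_left (by omega), max_eq_left (by omega)]
    push_cast; ring

/-- The discrete Poisson equation is solved by summation against the Green's function. -/
theorem eq_sum_greenKernel {t : ℚ} (ht : 0 ≤ t) {m : ℕ} {f h : ℕ → ℚ} (hm : 0 < m)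
    (hfm : f m = 0) (hf0 : f 1 - (1 + t) * f 0 = -(1 + t * m) * h 0)
    (hf : ∀ c, c + 2 ≤ m → f (c + 2) - 2 * f (c + 1) + f c = -(1 + t * m) * h (c + 1))
    {c : ℕ} (hc : c ≤ m) : f c = ∑ a ∈ range m, greenKernel t m a c * h a := by
  set G : ℕ → ℚ := fun c => ∑ a ∈ range m, greenKernel t m a c * h a with hG
  have hGm : G m = 0 := sum_eq_zero fun a ha => by
    rw [greenKernel_self_right t (mem_range.1 ha), zero_mul]
  have hG0 : G 1 - (1 + t) * G 0 = -(1 + t * m) * h 0 := by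
    have : G 1 - (1 + t) * G 0 =
        ∑ a ∈ range m, if a = 0 then -(1 + t * m) * h 0 else 0 := by
      simp only [hG, mul_sum, ← sum_sub_distrib]
      refine sum_congr rfl fun a _ => ?_
      rw [← mul_assoc, ← sub_mul, greenKernel_boundary]
      split_ifs with h0
      · rw [h0]
      · rw [zero_mul]
    rw [this, sum_ite_eq' (range m), if_pos (mem_range.2 hm)]
  have hG2 : ∀ c, c + 2 ≤ m → G (c + 2) - 2 * G (c + 1) + G c = -(1 + t * m) * h (c + 1) := by
    intro c hc
    have : G (c + 2) - 2 * G (c + 1) + G c =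
        ∑ a ∈ range m, if a = c + 1 then -(1 + t * m) * h (c + 1) else 0 := by
      simp only [hG, mul_sum, ← sum_sub_distrib, ← sum_add_distrib]
      refine sum_congr rfl fun a _ => ?_
      rw [← mul_assoc, ← sub_mul, ← add_mul, greenKernel_secondDifference]
      split_ifs with h0
      · rw [h0]
      · rw [zero_mul]
    rw [this, sum_ite_eq' (range m), if_pos (mem_range.2 (by omega))]
  -- The difference of the two solutions is the linear function `(1 + t c) d₀`, with a zero at `m`.
  have hd : ∀ c, c ≤ m → f c - G c = (1 + t * c) * (f 0 - G 0) := by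
    intro c
    induction c using Nat.twoStepInduction with
    | zero => intro _; simp
    | one => intro _; push_cast; linarith
    | more c ih1 ih2 =>
      intro hc
      have h1 := ih1 (by omega)
      have h2 := ih2 (by omega)
      have h3 := hf c hc
      have h4 := hG2 c hc
      push_cast at h2 ⊢
      linear_combination h3 - h4 + 2 * h2 - h1
  have h0 : f 0 - G 0 = 0 := by
    have := hd m le_rfl
    rw [hfm, hGm, sub_self] at this
    have hpos : 1 + t * (m : ℚ) ≠ 0 := by positivity
    exact (mul_eq_zero.1 this.symm).resolve_left hpos
  have := hd c hc
  rw [h0, mul_zero] at this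
  exact sub_eq_zero.1 this

/-! ### Central factorials -/

/-- The second difference maps the function `z (k + 1)` to `z k`. At the boundary point `0` the
missing value `z (k + 1) (-1)` is replaced by `(1 - t) * z (k + 1) 0`, as for `greenKernel t`. -/
def LowersIndex (t : ℚ) (z : ℕ → ℕ → ℚ) : Prop :=
  ∀ k, z (k + 1) 1 - (1 + t) * z (k + 1) 0 = z k 0 ∧
    ∀ c, z (k + 1) (c + 2) - 2 * z (k + 1) (c + 1) + z (k + 1) c = z k (c + 1)

/-- The even central factorial `binom (c + k) (2 k)`, a polynomial in `c` of degree `2 k` that is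
invariant under `c ↦ -1 - c`. -/
def evenFactorial (k c : ℕ) : ℚ := (c + k).choose (2 * k)

/-- The odd central factorial `(2 c + 1) / (2 k + 1) * binom (c + k) (2 k)`, a polynomial in `c` of
degree `2 k + 1` that changes sign under `c ↦ -1 - c`. -/
def oddFactorial (k c : ℕ) : ℚ := (2 * c + 1) / (2 * k + 1) * evenFactorial k c

theorem oddFactorial_eq (k c : ℕ) : oddFactorial k c =
    ((c + k + 1).choose (2 * k + 1) + (c + k).choose (2 * k + 1) : ℕ) := by
  have h1 := Nat.add_one_mul_choose_eq (c + k) (2 * k)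
  have h2 := Nat.choose_succ_succ (c + k) (2 * k)
  have hk : (2 * k + 1 : ℚ) ≠ 0 := by positivity
  have h1' : ((c + k + 1 : ℚ)) * ((c + k).choose (2 * k) : ℕ) =
      ((c + k + 1).choose (2 * k + 1) : ℕ) * (2 * k + 1) := by exact_mod_cast h1
  have h2' : (((c + k + 1).choose (2 * k + 1) : ℕ) : ℚ) =
      ((c + k).choose (2 * k) : ℕ) + ((c + k).choose (2 * k + 1) : ℕ) := by exact_mod_cast h2
  rw [oddFactorial, evenFactorial, div_mul_eq_mul_div, div_eq_iff hk]
  push_cast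
  linear_combination 2 * h1' + (2 * k + 1) * h2'

theorem choose_secondDifference (n k : ℕ) : ((n + 2).choose (k + 2) : ℚ) -
    2 * ((n + 1).choose (k + 2) : ℚ) + (n.choose (k + 2) : ℚ) = (n.choose k : ℚ) := by
  rw [Nat.choose_succ_succ (n + 1) (k + 1), Nat.choose_succ_succ n (k + 1),
    Nat.choose_succ_succ n k]
  push_cast
  ring

theorem lowersIndex_evenFactorial (t : ℚ) : LowersIndex t evenFactorial := by
  refine fun k => ⟨?_, fun c => ?_⟩
  · rcases k with _ | k
    · simp [evenFactorial]
    · simp only [evenFactorial]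
      rw [Nat.choose_eq_zero_of_lt (by omega), Nat.choose_eq_zero_of_lt (by omega),
        Nat.choose_eq_zero_of_lt (by omega)]
      simp
  · have := choose_secondDifference (c + (k + 1)) (2 * k)
    simp only [evenFactorial]
    rw [show c + 1 + k = c + (k + 1) by ring, ← this]
    rw [show c + 2 + (k + 1) = c + (k + 1) + 2 by ring,
      show c + 1 + (k + 1) = c + (k + 1) + 1 by ring, show 2 * (k + 1) = 2 * k + 2 by ring]

theorem lowersIndex_oddFactorial (t : ℚ) : LowersIndex t oddFactorial := by
  refine fun k => ⟨?_, fun c => ?_⟩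
  · simp only [oddFactorial_eq]
    rcases k with _ | k
    · simp [Nat.choose_eq_zero_of_lt (show 1 < 3 by norm_num)]
    · rw [Nat.choose_eq_zero_of_lt (show 1 + (k + 1 + 1) + 1 < 2 * (k + 1 + 1) + 1 by omega),
        Nat.choose_eq_zero_of_lt (show 1 + (k + 1 + 1) < 2 * (k + 1 + 1) + 1 by omega),
        Nat.choose_eq_zero_of_lt (show 0 + (k + 1 + 1) + 1 < 2 * (k + 1 + 1) + 1 by omega),
        Nat.choose_eq_zero_of_lt (show 0 + (k + 1 + 1) < 2 * (k + 1 + 1) + 1 by omega),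
        Nat.choose_eq_zero_of_lt (show 0 + (k + 1) + 1 < 2 * (k + 1) + 1 by omega),
        Nat.choose_eq_zero_of_lt (show 0 + (k + 1) < 2 * (k + 1) + 1 by omega)]
      simp
  · have h1 := choose_secondDifference (c + (k + 1)) (2 * k + 1)
    have h2 := choose_secondDifference (c + (k + 1) + 1) (2 * k + 1)
    simp only [oddFactorial_eq]
    rw [show c + 2 + (k + 1) = c + (k + 1) + 2 by ring,
      show c + 1 + (k + 1) = c + (k + 1) + 1 by ring, show 2 * (k + 1) + 1 = 2 * k + 1 + 2 by ring,
      show c + 1 + k = c + (k + 1) by ring]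
    push_cast
    linear_combination h1 + h2

/-- Iterated summation against the Green's function, in the basis of central factorials. The
coefficients `C` are those that make each iterate vanish at `m`. -/
theorem iterate_greenKernel {t : ℚ} (ht : 0 ≤ t) {m : ℕ} (hm : 0 < m) {w z : ℕ → ℕ → ℚ}
    (hw : LowersIndex t w) (hz : LowersIndex t z) (hz0 : z 0 1 = (1 + t) * z 0 0)
    (hz0' : ∀ c, z 0 (c + 2) - 2 * z 0 (c + 1) + z 0 c = 0) (l : ℚ) (C : ℕ → ℚ) {f : ℕ → ℕ → ℚ}
    (hf : ∀ s c, f s c = l * (-(1 + t * m)) ^ s * w s c +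
      ∑ x ∈ antidiagonal s, C x.1 * (-(1 + t * m)) ^ x.2 * z x.2 c)
    (hfm : ∀ s, f s m = 0) (s : ℕ) {c : ℕ} (hc : c ≤ m) :
    f (s + 1) c = ∑ a ∈ range m, greenKernel t m a c * f s a := by
  refine eq_sum_greenKernel ht hm (hfm _) ?_ ?_ hc
  · rw [hf, hf, hf, Nat.sum_antidiagonal_succ', Nat.sum_antidiagonal_succ', mul_add]
    have h1 := (hw s).1
    have h2 : ∑ x ∈ antidiagonal s, C x.1 * (-(1 + t * m)) ^ (x.2 + 1) * z (x.2 + 1) 1 -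
        (1 + t) * ∑ x ∈ antidiagonal s, C x.1 * (-(1 + t * m)) ^ (x.2 + 1) * z (x.2 + 1) 0 =
        ∑ x ∈ antidiagonal s, -(1 + t * m) * (C x.1 * (-(1 + t * m)) ^ x.2 * z x.2 0) := by
      rw [mul_sum, ← sum_sub_distrib]
      refine sum_congr rfl fun x _ => ?_
      have := (hz x.2).1
      linear_combination C x.1 * (-(1 + t * m)) ^ (x.2 + 1) * this
    rw [← mul_sum] at h2
    linear_combination h2 + l * (-(1 + t * m)) ^ (s + 1) * h1 + C (s + 1) * hz0
  · intro c _
    rw [hf, hf, hf, hf, Nat.sum_antidiagonal_succ', Nat.sum_antidiagonal_succ',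
      Nat.sum_antidiagonal_succ', mul_add]
    have h1 := (hw s).2 c
    have h2 : ∑ x ∈ antidiagonal s, C x.1 * (-(1 + t * m)) ^ (x.2 + 1) * z (x.2 + 1) (c + 2) -
        2 * ∑ x ∈ antidiagonal s, C x.1 * (-(1 + t * m)) ^ (x.2 + 1) * z (x.2 + 1) (c + 1) +
        ∑ x ∈ antidiagonal s, C x.1 * (-(1 + t * m)) ^ (x.2 + 1) * z (x.2 + 1) c =
        ∑ x ∈ antidiagonal s, -(1 + t * m) * (C x.1 * (-(1 + t * m)) ^ x.2 * z x.2 (c + 1)) := by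
      rw [mul_sum, ← sum_sub_distrib, ← sum_add_distrib]
      refine sum_congr rfl fun x _ => ?_
      have := (hz x.2).2 c
      linear_combination C x.1 * (-(1 + t * m)) ^ (x.2 + 1) * this
    rw [← mul_sum] at h2
    linear_combination h2 + l * (-(1 + t * m)) ^ (s + 1) * h1 + C (s + 1) * hz0' c

/-! ### Modified Bernoulli numbers -/

/-- `modifiedBernoulli n` is a positive multiple of `ζ(2 n)`. -/
theorem modifiedBernoulli_ne_zero {n : ℕ} (hn : n ≠ 0) : modifiedBernoulli n ≠ 0 := by
  intro h
  have hB : bernoulli (2 * n) = 0 := by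
    have hf : ((2 * n).factorial : ℚ) ≠ 0 := by positivity
    simpa [modifiedBernoulli, hf] using h
  have hs := hasSum_zeta_nat hn
  rw [hB] at hs
  simp only [Rat.cast_zero, mul_zero, zero_div] at hs
  have := (hasSum_zero_iff_of_nonneg fun i => by positivity).1 hs
  simpa using congrFun this 1

theorem sum_range_two_mul {M : Type*} [AddCommMonoid M] (f : ℕ → M) (n : ℕ) :
    ∑ i ∈ range (2 * n), f i = ∑ i ∈ range n, (f (2 * i) + f (2 * i + 1)) := by
  induction n with
  | zero => simp
  | succ n ih => rw [mul_add, mul_one, sum_range_succ, sum_range_succ, ih, sum_range_succ, add_assoc]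

theorem bernoulli_eval_half (s : ℕ) :
    (Polynomial.bernoulli (2 * s + 1)).eval (1 / 2) = 0 := by
  have := Polynomial.bernoulli_eval_one_sub (2 * s + 1) (1 / 2)
  rw [pow_succ, pow_mul] at this
  norm_num at this ⊢
  linarith

/-- The recursion of the modified Bernoulli numbers, equivalent to
`(∑ B̃ᵢ tⁱ) * sin (√t / 2) / (√t / 2) = - cos (√t / 2) / 2`. It expresses that the Bernoulli
polynomials of odd index vanish at `1 / 2`. -/
theorem sum_modifiedBernoulli (s : ℕ) :
    ∑ x ∈ antidiagonal s, modifiedBernoulli x.1 *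
      ((-1) ^ x.2 / (4 ^ x.2 * (2 * x.2 + 1).factorial)) =
      -(1 / 2) * (-1) ^ s / (4 ^ s * (2 * s).factorial) := by
  have h := bernoulli_eval_half s
  rw [Polynomial.bernoulli, Polynomial.eval_finsetSum, show 2 * s + 1 + 1 = 2 * (s + 1) by ring,
    sum_range_two_mul, sum_add_distrib] at h
  -- Among the odd indices only `B₁ = -1 / 2` contributes.
  have hodd : ∑ i ∈ range (s + 1), Polynomial.eval (1 / 2 : ℚ) (Polynomial.monomial
      (2 * s + 1 - (2 * i + 1)) (bernoulli (2 * i + 1) * ((2 * s + 1).choose (2 * i + 1) : ℕ))) =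
      -(1 / 2) * (2 * s + 1) / 4 ^ s := by
    rw [sum_eq_single_of_mem 0 (by simp)]
    · simp only [Polynomial.eval_monomial]
      rw [mul_zero, zero_add, bernoulli_one, Nat.choose_one_right, Nat.add_sub_cancel, pow_mul]
      have h5 : ((1 / 2 : ℚ) ^ 2) ^ s = 1 / 4 ^ s := by
        rw [← one_div_pow]; norm_num
      rw [h5]
      push_cast
      ring
    · intro i _ hi
      rw [bernoulli_eq_zero_of_odd (odd_two_mul_add_one i) (by omega)]
      simp
  have heven : ∑ i ∈ range (s + 1), Polynomial.eval (1 / 2 : ℚ) (Polynomial.monomial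
      (2 * s + 1 - 2 * i) (bernoulli (2 * i) * ((2 * s + 1).choose (2 * i) : ℕ))) =
      -((-1) ^ s * (2 * s + 1).factorial) * ∑ x ∈ antidiagonal s, modifiedBernoulli x.1 *
        ((-1) ^ x.2 / (4 ^ x.2 * (2 * x.2 + 1).factorial)) := by
    rw [Nat.sum_antidiagonal_eq_sum_range_succ_mk, mul_sum]
    refine sum_congr rfl fun i hi => ?_
    obtain ⟨j, rfl⟩ : ∃ j, s = i + j := ⟨s - i, by have := mem_range.1 hi; omega⟩
    simp only [Polynomial.eval_monomial, modifiedBernoulli, Nat.add_sub_cancel_left]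
    rw [show 2 * (i + j) + 1 - 2 * i = 2 * j + 1 by omega,
      Nat.cast_choose ℚ (show 2 * i ≤ 2 * (i + j) + 1 by omega),
      show 2 * (i + j) + 1 - 2 * i = 2 * j + 1 by omega, pow_succ (1 / 2 : ℚ),
      pow_mul, pow_add, pow_succ (-1 : ℚ) i]
    have h1 : ((2 * i).factorial : ℚ) ≠ 0 := by positivity
    have h2 : ((2 * j + 1).factorial : ℚ) ≠ 0 := by positivity
    have h3 : ((-1 : ℚ) ^ i) * (-1) ^ i = 1 := by rw [← mul_pow]; norm_num
    have h4 : ((-1 : ℚ) ^ j) * (-1) ^ j = 1 := by rw [← mul_pow]; norm_num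
    have h5 : ((1 / 2 : ℚ) ^ 2) ^ j = 1 / 4 ^ j := by
      rw [← one_div_pow]; norm_num
    rw [h5]
    field_simp
    linear_combination -bernoulli (2 * i) * ((-1) ^ j * (-1) ^ j) * h3 - bernoulli (2 * i) * h4
  rw [hodd, heven] at h
  have hf : ((2 * s + 1).factorial : ℚ) = (2 * s + 1) * (2 * s).factorial := by
    rw [Nat.factorial_succ]; push_cast; ring
  have h1 : ((2 * s).factorial : ℚ) ≠ 0 := by positivity
  have h3 : ((-1 : ℚ) ^ s) * (-1) ^ s = 1 := by rw [← mul_pow]; norm_num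
  have h6 : (2 * s + 1 : ℚ) ≠ 0 := by positivity
  rw [hf] at h
  generalize (∑ x ∈ antidiagonal s, modifiedBernoulli x.1 *
        ((-1 : ℚ) ^ x.2 / (4 ^ x.2 * (2 * x.2 + 1).factorial))) = S at *
  have h7 : (-1 : ℚ) ^ s * (2 * s).factorial * S = -(1 / 2) / 4 ^ s := by
    apply mul_left_cancel₀ h6
    linear_combination -h
  rw [eq_div_iff (by positivity)]
  have h8 : (4 : ℚ) ^ s * (-(1 / 2) / 4 ^ s) = -(1 / 2) := by field_simp
  linear_combination 4 ^ s * (-1) ^ s * h7 + (-1) ^ s * h8 - S * 4 ^ s * (2 * s).factorial * h3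

/-! ### Degrees and top coefficients of solutions of convolution equations -/

section Convolution

open Polynomial

/-- A convolution equation with leading coefficient `1` is solvable: invert a power series. -/
theorem exists_convolution_eq {R : Type*} [CommRing R] (z b : ℕ → R) (hz : z 0 = 1) :
    ∃ x : ℕ → R, ∀ s, ∑ i ∈ antidiagonal s, x i.1 * z i.2 = b s := by
  refine ⟨fun s => PowerSeries.coeff s
    (PowerSeries.mk b * PowerSeries.invOfUnit (PowerSeries.mk z) 1), fun s => ?_⟩
  have h : PowerSeries.mk b * PowerSeries.invOfUnit (PowerSeries.mk z) 1 * PowerSeries.mk z =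
      PowerSeries.mk b := by
    rw [mul_assoc, mul_comm (PowerSeries.invOfUnit _ _), PowerSeries.mul_invOfUnit, mul_one]
    simp [hz]
  have h' := congrArg (PowerSeries.coeff s) h
  rw [PowerSeries.coeff_mul, PowerSeries.coeff_mk] at h'
  simpa only [PowerSeries.coeff_mk] using h'

/-- If the degrees of the coefficients `z k` and of the right-hand sides `b k` grow linearly with
slope `d`, so do those of the solution. -/
theorem natDegree_le_of_convolution_eq {x z b : ℕ → ℚ[X]} (d e : ℕ) (hz : z 0 = 1)
    (hzd : ∀ k, (z k).natDegree ≤ d * k) (hbd : ∀ k, (b k).natDegree ≤ d * k + e)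
    (h : ∀ s, ∑ i ∈ antidiagonal s, x i.1 * z i.2 = b s) (s : ℕ) :
    (x s).natDegree ≤ d * s + e := by
  induction s using Nat.strong_induction_on with
  | _ s ih =>
    rcases s with _ | s
    · have := h 0
      simp only [Nat.antidiagonal_zero, sum_singleton, hz, mul_one] at this
      rw [this]
      exact hbd 0
    · have hs := h (s + 1)
      rw [Nat.sum_antidiagonal_succ', hz, mul_one] at hs
      rw [eq_sub_of_add_eq hs]
      refine (natDegree_sub_le _ _).trans (max_le (hbd _) (natDegree_sum_le_of_forall_le _ _ ?_))
      rintro ⟨i, j⟩ hij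
      rw [HasAntidiagonal.mem_antidiagonal] at hij
      simp only at hij ⊢
      calc (x i * z (j + 1)).natDegree ≤ (x i).natDegree + (z (j + 1)).natDegree := natDegree_mul_le
        _ ≤ (d * i + e) + d * (j + 1) := add_le_add (ih i (by omega)) (hzd _)
        _ = d * (s + 1) + e := by rw [← hij]; ring

/-- The coefficients in the maximal possible degree satisfy the convolution equation of the maximal
coefficients, which determines them. -/
theorem coeff_of_convolution_eq {x z b : ℕ → ℚ[X]} {d : ℕ} {a ζ β : ℕ → ℚ} (hz : z 0 = 1)
    (hzd : ∀ k, (z k).natDegree ≤ d * k) (hbd : ∀ k, (b k).natDegree ≤ d * k)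
    (h : ∀ s, ∑ i ∈ antidiagonal s, x i.1 * z i.2 = b s)
    (hzc : ∀ k, (z k).coeff (d * k) = ζ k) (hbc : ∀ k, (b k).coeff (d * k) = β k)
    (ha : ∀ s, ∑ i ∈ antidiagonal s, a i.1 * ζ i.2 = β s) (s : ℕ) :
    (x s).coeff (d * s) = a s := by
  have hxd := natDegree_le_of_convolution_eq d 0 hz hzd hbd h
  have hζ : ζ 0 = 1 := by rw [← hzc 0, hz]; simp
  induction s using Nat.strong_induction_on with
  | _ s ih =>
    rcases s with _ | s
    · have h0 := h 0
      have a0 := ha 0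
      simp only [Nat.antidiagonal_zero, sum_singleton, hz, hζ, mul_one] at h0 a0
      rw [h0, a0, hbc]
    · have hs := h (s + 1)
      have as := ha (s + 1)
      rw [Nat.sum_antidiagonal_succ', hz, mul_one] at hs
      rw [Nat.sum_antidiagonal_succ', hζ, mul_one] at as
      rw [eq_sub_of_add_eq hs, eq_sub_of_add_eq as, coeff_sub, hbc, finsetSum_coeff]
      congr 1
      refine sum_congr rfl ?_
      rintro ⟨i, j⟩ hij
      rw [HasAntidiagonal.mem_antidiagonal] at hij
      simp only at hij ⊢
      have hi := hxd i
      rw [add_zero] at hi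
      rw [show d * (s + 1) = d * i + d * (j + 1) by rw [← hij]; ring,
        coeff_mul_add_eq_of_natDegree_le hi (hzd _), ih i (by omega), hzc]

/-! ### Central factorials as polynomials in `p` -/

/-- The even central factorial at `m`, as a polynomial in `p = 2 m + 1`. -/
noncomputable def evenFactorialPoly : ℕ → ℚ[X]
  | 0 => 1
  | k + 1 => evenFactorialPoly k *
      (C (1 / (4 * (2 * k + 1) * (2 * k + 2) : ℚ)) * (X ^ 2 - C ((2 * k + 1) ^ 2 : ℚ)))

theorem evenFactorial_succ (k m : ℕ) : evenFactorial (k + 1) m =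
    evenFactorial k m * (1 / (4 * (2 * k + 1) * (2 * k + 2)) *
      ((2 * m + 1) ^ 2 - (2 * k + 1) ^ 2)) := by
  rcases lt_or_ge m (k + 1) with h | h
  · rw [evenFactorial, Nat.choose_eq_zero_of_lt (by omega)]
    rcases (Nat.lt_succ_iff.1 h).lt_or_eq with h' | h'
    · rw [evenFactorial, Nat.choose_eq_zero_of_lt (by omega)]
      simp
    · rw [h']; simp
  · obtain ⟨r, rfl⟩ : ∃ r, m = k + 1 + r := ⟨m - (k + 1), by omega⟩
    rw [evenFactorial, evenFactorial,
      Nat.cast_choose ℚ (show 2 * (k + 1) ≤ k + 1 + r + (k + 1) by omega),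
      Nat.cast_choose ℚ (show 2 * k ≤ k + 1 + r + k by omega),
      show k + 1 + r + (k + 1) - 2 * (k + 1) = r by omega,
      show k + 1 + r + k - 2 * k = r + 1 by omega,
      show k + 1 + r + (k + 1) = k + 1 + r + k + 1 by ring,
      show 2 * (k + 1) = 2 * k + 1 + 1 by ring]
    simp only [Nat.factorial_succ]
    have h1 : (r.factorial : ℚ) ≠ 0 := by positivity
    have h2 : ((2 * k).factorial : ℚ) ≠ 0 := by positivity
    have h3 : ((r : ℚ) + 1) ≠ 0 := by positivity
    have h4 : (2 * (k : ℚ) + 1) ≠ 0 := by positivity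
    have h5 : (2 * (k : ℚ) + 1 + 1) ≠ 0 := by positivity
    have h6 : (2 * (k : ℚ) + 2) ≠ 0 := by positivity
    push_cast
    field_simp
    ring

theorem evenFactorialPoly_eval (k m : ℕ) :
    (evenFactorialPoly k).eval (2 * m + 1 : ℚ) = evenFactorial k m := by
  induction k with
  | zero => simp [evenFactorialPoly, evenFactorial]
  | succ k ih => rw [evenFactorialPoly, eval_mul, ih, evenFactorial_succ]; simp

theorem natDegree_quadratic (a b : ℚ) : (C a * (X ^ 2 - C b)).natDegree ≤ 2 := by
  compute_degree

theorem evenFactorialPoly_natDegree (k : ℕ) : (evenFactorialPoly k).natDegree ≤ 2 * k := by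
  induction k with
  | zero => simp [evenFactorialPoly]
  | succ k ih => exact natDegree_mul_le.trans (add_le_add ih (natDegree_quadratic _ _))

theorem evenFactorialPoly_coeff (k : ℕ) :
    (evenFactorialPoly k).coeff (2 * k) = 1 / (4 ^ k * (2 * k).factorial) := by
  induction k with
  | zero => simp [evenFactorialPoly]
  | succ k ih =>
    rw [evenFactorialPoly, show 2 * (k + 1) = 2 * k + 2 by ring, coeff_mul_add_eq_of_natDegree_le
      (evenFactorialPoly_natDegree k) (natDegree_quadratic _ _), ih, coeff_C_mul, coeff_sub,
      coeff_X_pow, coeff_C]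
    simp only [Nat.factorial_succ, pow_succ]
    push_cast
    norm_num
    have h2 : ((2 * k).factorial : ℚ) ≠ 0 := by positivity
    field_simp
    ring

/-- The odd central factorial at `m` divided by `p = 2 m + 1`, as a polynomial in `p`. -/
noncomputable def oddFactorialPoly (k : ℕ) : ℚ[X] := C (1 / (2 * k + 1 : ℚ)) * evenFactorialPoly k

theorem oddFactorialPoly_eval (k m : ℕ) :
    (2 * m + 1) * (oddFactorialPoly k).eval (2 * m + 1 : ℚ) = oddFactorial k m := by
  rw [oddFactorialPoly, eval_mul, eval_C, evenFactorialPoly_eval, oddFactorial]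
  ring

theorem oddFactorialPoly_natDegree (k : ℕ) : (oddFactorialPoly k).natDegree ≤ 2 * k :=
  (natDegree_C_mul_le _ _).trans (evenFactorialPoly_natDegree k)

theorem oddFactorialPoly_coeff (k : ℕ) :
    (oddFactorialPoly k).coeff (2 * k) = 1 / (4 ^ k * (2 * k + 1).factorial) := by
  rw [oddFactorialPoly, coeff_C_mul, evenFactorialPoly_coeff, Nat.factorial_succ]
  push_cast
  field_simp

end Convolution

/-! ### The counts as polynomials in `p` -/

open Polynomial

theorem weightedCount_eq_of_greenKernel {ε t : ℚ} (hε : ε ^ 2 = 1) {m : ℕ} {f : ℕ → ℕ → ℚ}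
    (hK : ∀ a c, a < m → c < m → transferKernel ε m a c = greenKernel t m a c)
    (hf0 : ∀ c, f 0 c = m - c)
    (hf : ∀ s c, c ≤ m → f (s + 1) c = ∑ a ∈ range m, greenKernel t m a c * f s a)
    (s : ℕ) {c : ℕ} (hc : c < m) : weightedCount ε (2 * m + 1) (s + 1) c = f s c := by
  induction s generalizing c with
  | zero => rw [zero_add, weightedCount_one hε hc.le, hf0]
  | succ s ih =>
    rw [weightedCount_succ hε s hc, hf s c hc.le]
    refine sum_congr rfl fun a ha => ?_
    rw [mem_range] at ha
    rw [hK a c ha hc, ih ha]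

/-- The number of all colorings is a polynomial in `p` of degree `3 g - 3`, where `g = s + 1`. -/
theorem exists_poly_weightedCount_one (c s : ℕ) (hs : 2 ≤ s) :
    ∃ F : ℚ[X], (∀ m, c < m → weightedCount 1 (2 * m + 1) (s + 1) c = F.eval (2 * m + 1 : ℚ)) ∧
      F.natDegree ≤ 3 * s ∧ F.coeff (3 * s) = (2 * c + 1) * modifiedBernoulli s := by
  -- `A s` is the polynomial for which the solution of the `s`-th Poisson equation vanishes at `m`.
  obtain ⟨A, hA⟩ := exists_convolution_eq (fun k => (-X) ^ k * oddFactorialPoly k)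
    (fun k => C (-(1 / 2)) * ((-X) ^ k * evenFactorialPoly k))
    (by simp [oddFactorialPoly, evenFactorialPoly])
  have hz : ∀ k : ℕ, ((-X : ℚ[X]) ^ k).natDegree ≤ k := fun k => by
    rw [natDegree_pow, natDegree_neg, natDegree_X, mul_one]
  have hXc : ∀ k : ℕ, ((-X : ℚ[X]) ^ k).coeff k = (-1) ^ k := fun k => by
    rw [neg_pow, ← C_1, ← C_neg, ← C_pow, coeff_C_mul, coeff_X_pow_self, mul_one]
  have hzd : ∀ k, ((-X) ^ k * oddFactorialPoly k).natDegree ≤ 3 * k := fun k =>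
    natDegree_mul_le.trans ((add_le_add (hz k) (oddFactorialPoly_natDegree k)).trans (by omega))
  have hbd : ∀ k, (C (-(1 / 2)) * ((-X) ^ k * evenFactorialPoly k)).natDegree ≤ 3 * k := fun k =>
    (natDegree_C_mul_le _ _).trans (natDegree_mul_le.trans
      ((add_le_add (hz k) (evenFactorialPoly_natDegree k)).trans (by omega)))
  have hAd : ∀ k, (A k).natDegree ≤ 3 * k :=
    natDegree_le_of_convolution_eq 3 0 (by simp [oddFactorialPoly, evenFactorialPoly]) hzd hbd hA
  have hAc : ∀ k, (A k).coeff (3 * k) = modifiedBernoulli k := by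
    refine coeff_of_convolution_eq
      (ζ := fun k => (-1) ^ k / (4 ^ k * (2 * k + 1).factorial))
      (β := fun k => -(1 / 2) * (-1) ^ k / (4 ^ k * (2 * k).factorial))
      (by simp [oddFactorialPoly, evenFactorialPoly]) hzd hbd hA
      (fun k => ?_) (fun k => ?_) sum_modifiedBernoulli
    · rw [show 3 * k = k + 2 * k by ring, coeff_mul_add_eq_of_natDegree_le (hz k)
        (oddFactorialPoly_natDegree k), hXc, oddFactorialPoly_coeff]
      ring
    · rw [coeff_C_mul, show 3 * k = k + 2 * k by ring, coeff_mul_add_eq_of_natDegree_le (hz k)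
        (evenFactorialPoly_natDegree k), hXc, evenFactorialPoly_coeff]
      ring
  refine ⟨C (evenFactorial s c / 2) * (X * (-X) ^ s) +
    ∑ x ∈ antidiagonal s, A x.1 * (-X) ^ x.2 * C (oddFactorial x.2 c), ?_, ?_, ?_⟩
  · intro m hc
    have hm : 0 < m := by omega
    set f : ℕ → ℕ → ℚ := fun s c => (2 * m + 1) / 2 * (-(1 + 2 * m)) ^ s * evenFactorial s c +
      ∑ x ∈ antidiagonal s, (A x.1).eval (2 * m + 1 : ℚ) * (-(1 + 2 * m)) ^ x.2 *
        oddFactorial x.2 c with hf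
    have hfm : ∀ s, f s m = 0 := by
      intro s
      have h := congrArg (eval (2 * m + 1 : ℚ)) (hA s)
      simp only [eval_finsetSum, eval_mul, eval_C, eval_pow, eval_neg, eval_X,
        evenFactorialPoly_eval] at h
      have h' : ∑ x ∈ antidiagonal s, (A x.1).eval (2 * m + 1 : ℚ) * (-(1 + 2 * m)) ^ x.2 *
          oddFactorial x.2 m = (2 * m + 1) * ∑ x ∈ antidiagonal s,
            (A x.1).eval (2 * m + 1 : ℚ) * ((-(2 * m + 1)) ^ x.2 *
              (oddFactorialPoly x.2).eval (2 * m + 1 : ℚ)) := by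
        rw [mul_sum]
        refine sum_congr rfl fun x _ => ?_
        rw [← oddFactorialPoly_eval, add_comm (1 : ℚ)]
        ring
      rw [hf]
      simp only
      rw [h', h, add_comm (1 : ℚ)]
      ring
    have hf0 : ∀ c, f 0 c = m - c := by
      intro c
      have h := congrArg (eval (2 * m + 1 : ℚ)) (hA 0)
      simp [oddFactorialPoly, evenFactorialPoly] at h
      simp [hf, h, oddFactorial, evenFactorial]
      ring
    have hstep : ∀ s c, c ≤ m → f (s + 1) c = ∑ a ∈ range m, greenKernel 2 m a c * f s a :=
      fun s c hc => iterate_greenKernel zero_le_two hm (lowersIndex_evenFactorial 2)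
        (lowersIndex_oddFactorial 2) (by norm_num [oddFactorial, evenFactorial])
        (fun c => by simp [oddFactorial, evenFactorial]; ring) ((2 * m + 1) / 2)
        (fun k => (A k).eval (2 * m + 1 : ℚ)) (f := f) (fun _ _ => rfl) hfm s hc
    rw [weightedCount_eq_of_greenKernel (by norm_num) (fun a c => transferKernel_one) hf0 hstep s
      hc]
    simp only [hf, eval_add, eval_mul, eval_C, eval_X, eval_pow, eval_neg, eval_finsetSum]
    rw [add_comm (1 : ℚ)]
    ring
  · refine natDegree_add_le_of_degree_le ?_ (natDegree_sum_le_of_forall_le _ _ ?_)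
    · refine (natDegree_C_mul_le _ _).trans (natDegree_mul_le.trans ?_)
      have := hz s
      rw [natDegree_X]
      omega
    · intro x hx
      rw [HasAntidiagonal.mem_antidiagonal] at hx
      refine (natDegree_mul_C_le _ _).trans (natDegree_mul_le.trans ?_)
      have := hz x.2
      have := hAd x.1
      omega
  · have h0 : (C (evenFactorial s c / 2) * (X * (-X) ^ s)).coeff (3 * s) = 0 := by
      refine coeff_eq_zero_of_natDegree_lt (lt_of_le_of_lt
        ((natDegree_C_mul_le _ _).trans natDegree_mul_le) ?_)
      have := hz s
      rw [natDegree_X]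
      omega
    -- Only the linear central factorial `2 c + 1` contributes in degree `3 s`.
    rw [coeff_add, h0, zero_add, finsetSum_coeff, sum_eq_single_of_mem (s, 0) (by simp)]
    · simp only [pow_zero, mul_one, coeff_mul_C, hAc]
      simp [oddFactorial, evenFactorial]
      ring
    · intro x hx hne
      rw [HasAntidiagonal.mem_antidiagonal] at hx
      have hx2 : x.2 ≠ 0 := fun h => hne (Prod.ext (by simp; omega) h)
      refine coeff_eq_zero_of_natDegree_lt (lt_of_le_of_lt
        ((natDegree_mul_C_le _ _).trans natDegree_mul_le) ?_)
      have := hz x.2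
      have := hAd x.1
      omega

/-- The difference of the numbers of even and odd colorings is a polynomial in `p` of degree at
most `2 g - 1`, where `g = s + 1`. -/
theorem exists_poly_weightedCount_neg_one (c s : ℕ) :
    ∃ H : ℚ[X], (∀ m, c < m → weightedCount (-1) (2 * m + 1) (s + 1) c = H.eval (2 * m + 1 : ℚ)) ∧
      H.natDegree ≤ 2 * s + 1 := by
  obtain ⟨B, hB⟩ := exists_convolution_eq (fun k => C ((-1) ^ k) * evenFactorialPoly k)
    (fun k => C ((-1) ^ k / 2) * (X * oddFactorialPoly k))
    (by simp [evenFactorialPoly])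
  have hBd : ∀ k, (B k).natDegree ≤ 2 * k + 1 := by
    refine natDegree_le_of_convolution_eq 2 1 (by simp [evenFactorialPoly])
      (fun k => (natDegree_C_mul_le _ _).trans (evenFactorialPoly_natDegree k))
      (fun k => (natDegree_C_mul_le _ _).trans (natDegree_mul_le.trans ?_)) hB
    have := oddFactorialPoly_natDegree k
    rw [natDegree_X]
    omega
  refine ⟨C (-(1 / 2) * (-1) ^ s * oddFactorial s c) +
    ∑ x ∈ antidiagonal s, B x.1 * C ((-1) ^ x.2 * evenFactorial x.2 c), ?_, ?_⟩
  · intro m hc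
    have hm : 0 < m := by omega
    set f : ℕ → ℕ → ℚ := fun s c => -(1 / 2) * (-(1 + 0 * m)) ^ s * oddFactorial s c +
      ∑ x ∈ antidiagonal s, (B x.1).eval (2 * m + 1 : ℚ) * (-(1 + 0 * m)) ^ x.2 *
        evenFactorial x.2 c with hf
    have hfm : ∀ s, f s m = 0 := by
      intro s
      have h := congrArg (eval (2 * m + 1 : ℚ)) (hB s)
      simp only [eval_finsetSum, eval_mul, eval_C, eval_X, evenFactorialPoly_eval,
        oddFactorialPoly_eval] at h
      simp only [hf, zero_mul, add_zero, mul_assoc] at h ⊢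
      rw [h]
      ring
    have hf0 : ∀ c, f 0 c = m - c := by
      intro c
      have h := congrArg (eval (2 * m + 1 : ℚ)) (hB 0)
      simp [oddFactorialPoly, evenFactorialPoly] at h
      simp [hf, h, oddFactorial, evenFactorial]
      ring
    have hstep : ∀ s c, c ≤ m → f (s + 1) c = ∑ a ∈ range m, greenKernel 0 m a c * f s a :=
      fun s c hc => iterate_greenKernel le_rfl hm (lowersIndex_oddFactorial 0)
        (lowersIndex_evenFactorial 0) (by norm_num [evenFactorial])
        (fun c => by simp [evenFactorial]; ring) (-(1 / 2))
        (fun k => (B k).eval (2 * m + 1 : ℚ)) (f := f) (fun _ _ => rfl) hfm s hc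
    rw [weightedCount_eq_of_greenKernel (by norm_num) (fun a c => transferKernel_neg_one) hf0 hstep
      s hc]
    simp only [hf, eval_add, eval_mul, eval_C, eval_finsetSum, zero_mul, add_zero, mul_assoc]
  · refine natDegree_add_le_of_degree_le ((natDegree_C _).le.trans (by omega))
      (natDegree_sum_le_of_forall_le _ _ ?_)
    intro x hx
    rw [HasAntidiagonal.mem_antidiagonal] at hx
    refine (natDegree_mul_C_le _ _).trans ((hBd x.1).trans ?_)
    omega

theorem natDegree_and_leadingCoeff_of_coeff {P : ℚ[X]} {n : ℕ} {a : ℚ} (hP : P.natDegree ≤ n)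
    (hc : P.coeff n = a) (ha : a ≠ 0) : P.natDegree = n ∧ P.leadingCoeff = a := by
  have h : P.natDegree = n := natDegree_eq_of_le_of_coeff_ne_zero hP (hc ▸ ha)
  exact ⟨h, by rw [leadingCoeff, h, hc]⟩

theorem corollary2p7 (g : ℕ) (hg : 3 ≤ g) (c : ℕ) :
    ∃ E O : Polynomial ℚ,
      (∀ p : ℕ, p.Prime → 5 ≤ p → c ≤ (p - 3) / 2 →
        (evenColorings p g c : ℚ) = E.eval (p : ℚ) ∧
        (oddColorings p g c : ℚ) = O.eval (p : ℚ)) ∧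
      E.natDegree = 3 * g - 3 ∧
      E.leadingCoeff = ((c : ℚ) + 1 / 2) * modifiedBernoulli (g - 1) ∧
      O.natDegree = 3 * g - 3 ∧
      O.leadingCoeff = ((c : ℚ) + 1 / 2) * modifiedBernoulli (g - 1) := by
  obtain ⟨s, rfl⟩ : ∃ s, g = s + 1 := ⟨g - 1, by omega⟩
  obtain ⟨F, hF, hFd, hFc⟩ := exists_poly_weightedCount_one c s (by omega)
  obtain ⟨H, hH, hHd⟩ := exists_poly_weightedCount_neg_one c s
  -- `2 s + 1 < 3 s` because `s ≥ 2`: the difference does not affect the leading terms.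
  have hHc : H.coeff (3 * s) = 0 := coeff_eq_zero_of_natDegree_lt (by omega)
  have hHd' : H.natDegree ≤ 3 * s := by omega
  have hne : ((c : ℚ) + 1 / 2) * modifiedBernoulli s ≠ 0 :=
    mul_ne_zero (by positivity) (modifiedBernoulli_ne_zero (by omega))
  have hE := natDegree_and_leadingCoeff_of_coeff (P := C (1 / 2) * (F + H))
    ((natDegree_C_mul_le _ _).trans (natDegree_add_le_of_degree_le hFd hHd'))
    (a := ((c : ℚ) + 1 / 2) * modifiedBernoulli s)
    (by rw [coeff_C_mul, coeff_add, hFc, hHc]; ring) hne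
  have hO := natDegree_and_leadingCoeff_of_coeff (P := C (1 / 2) * (F - H))
    ((natDegree_C_mul_le _ _).trans ((natDegree_sub_le _ _).trans (max_le hFd hHd')))
    (a := ((c : ℚ) + 1 / 2) * modifiedBernoulli s)
    (by rw [coeff_C_mul, coeff_sub, hFc, hHc]; ring) hne
  rw [show 3 * (s + 1) - 3 = 3 * s by omega, Nat.add_sub_cancel]
  refine ⟨C (1 / 2) * (F + H), C (1 / 2) * (F - H), ?_, hE.1, hE.2, hO.1, hO.2⟩
  intro p hp h5 hc
  obtain ⟨m, rfl⟩ := hp.odd_of_ne_two (by omega)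
  rw [evenColorings_eq, oddColorings_eq, hF m (by omega), hH m (by omega)]
  push_cast
  simp only [eval_mul, eval_C, eval_add, eval_sub]
  constructor <;> ring
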